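/- Let $p\ge 1$ be an integer. There is a constant $C_p>0$ depending only on $p$ such that the following holds. Let $d\ge 1$ and $n\ge 2$ be integers and let $\Sigma\in\mathbb{R}^{d\times d}$ be symmetric positive definite, with largest eigenvalue $\sigma_1^2$ ($\sigma_1>0$) and effective dimension $d_{\mathrm{eff}}=\operatorname{Tr}(\Sigma)/\sigma_1^2$. A random vector $X\in\mathbb{R}^d$ is called $\Sigma$-subgaussian if $\mathbb{P}(|X^\top x|>t)\le 2\exp\big(-\tfrac12\, t^2/(x^\top\Sigma x)\big)$ for all $t>0$ and all nonzero $x\in\mathbb{R}^d$ with $\|x\|\le 1$. Let $T_1,\dots,T_n$ be i.i.d. random tensors of order $p$ on $\mathbb{R}^d$, each of the form $T_i=X_i^{\otimes p}$ with $X_i$ a $\Sigma$-subgaussian random vector, and let $T=\frac1n\sum_{i=1}^nT_i$. For a tensor $A$ of order $p$ put $$\|A\|_{\mathrm{op}}=\sup_{\|x_1\otimes\cdots\otimes x_p\|\le 1}\langle A,x_1\otimes\cdots\otimes x_p\rangle,$$ where $\langle A,B\rangle=\sum_{i_1,\dots,i_p}A_{i_1\dots i_p}B_{i_1\dots i_p}$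 and $\|A\|^2=\langle A,A\rangle$. Then the entries of the $T_i$ are integrable, and for every $\delta>0$, with probability at least $1-\delta$, $$\|T-\mathbb{E}T\|_{\mathrm{op}}\le C_p\,\sigma_1^p\sqrt{\frac{\big(d_{\mathrm{eff}}+\ln d+\ln(\delta^{-1})\big)^{p+1}\ln(n)^p}{n}}$$ (for $\delta\ge 1$ this says nothing). Equivalently, with the same constant $C_p$, for every $\lambda>0$, $$\mathbb{P}\left(\|T-\mathbb{E}T\|_{\mathrm{op}}\ge C_p\,\sigma_1^p\sqrt{\frac{\big(d_{\mathrm{eff}}+\ln d+\lambda\big)^{p+1}\ln(n)^p}{n}}\right)\le e^{-\lambda}.$$ -/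

import Mathlib

open MeasureTheory ProbabilityTheory

open scoped Matrix

noncomputable section

/-- Real tensors of order `p` on `ℝ^d`: arrays indexed by `p`-tuples of coordinates. -/
abbrev Tensor (p d : ℕ) : Type := (Fin p → Fin d) → ℝ

namespace Tensor

variable {p d : ℕ}

/-- The entrywise scalar product of two tensors. -/
def scalarProd (T S : Tensor p d) : ℝ := ∑ J, T J * S J

/-- The Euclidean (Frobenius) norm of a tensor. -/
def frobNorm (T : Tensor p d) : ℝ := Real.sqrt (∑ J, T J ^ 2)

/-- The elementary tensor `x₁ ⊗ ⋯ ⊗ x_p`. -/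
def outer (x : Fin p → EuclideanSpace ℝ (Fin d)) : Tensor p d :=
  fun J => ∏ k, x k (J k)

/-- The symmetric rank-one tensor `x ⊗ ⋯ ⊗ x` with `p` factors. -/
def power (p : ℕ) (x : EuclideanSpace ℝ (Fin d)) : Tensor p d :=
  outer fun _ => x

/-- The operator norm: the supremum of `⟨T, x₁ ⊗ ⋯ ⊗ x_p⟩` over `‖x₁ ⊗ ⋯ ⊗ x_p‖ ≤ 1`. -/
def opNorm (T : Tensor p d) : ℝ :=
  sSup {r : ℝ | ∃ x : Fin p → EuclideanSpace ℝ (Fin d),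
    frobNorm (outer x) ≤ 1 ∧ r = scalarProd T (outer x)}

/-- The set whose supremum is the operator norm is bounded, so that supremum is a genuine one. -/
theorem bddAbove_opNorm_set (T : Tensor p d) :
    BddAbove {r : ℝ | ∃ x : Fin p → EuclideanSpace ℝ (Fin d),
      frobNorm (outer x) ≤ 1 ∧ r = scalarProd T (outer x)} := by
  refine ⟨frobNorm T, ?_⟩
  rintro r ⟨x, hx, rfl⟩
  calc scalarProd T (outer x) ≤ frobNorm T * frobNorm (outer x) :=
        Real.sum_mul_le_sqrt_mul_sqrt _ _ _
    _ ≤ frobNorm T * 1 := mul_le_mul_of_nonneg_left hx (Real.sqrt_nonneg _)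
    _ = frobNorm T := mul_one _

/-- The empirical mean `(1/n) ∑ T_i` of `n` random tensors. -/
def empiricalMean {Ω : Type*} {n : ℕ} (T : Fin n → Ω → Tensor p d) (ω : Ω) : Tensor p d :=
  fun J => (1 / (n : ℝ)) * ∑ i, T i ω J

/-- The expectation of a random tensor, entry by entry. -/
def expectation {Ω : Type*} [MeasurableSpace Ω] (μ : Measure Ω) (T : Ω → Tensor p d) :
    Tensor p d :=
  fun J => ∫ ω, T ω J ∂μ

end Tensor

/-- A random vector `a` is `S`-subgaussian if
`P(|aᵀx| > t) ≤ 2 exp(-t² / (2 xᵀSx))` for all `t > 0` and all `x` in the unit ball. -/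
def IsSubgaussianVec {d : ℕ} {Ω : Type*} [MeasurableSpace Ω] (S : Matrix (Fin d) (Fin d) ℝ)
    (a : Ω → EuclideanSpace ℝ (Fin d)) (μ : Measure Ω) : Prop :=
  Measurable a ∧ ∀ t : ℝ, 0 < t → ∀ x : EuclideanSpace ℝ (Fin d), ‖x‖ ≤ 1 →
    μ.real {ω | t < |inner ℝ (a ω) x|} ≤
      2 * Real.exp (-(1 / 2) * (t ^ 2 / (x.ofLp ⬝ᵥ (S *ᵥ x.ofLp))))

/-- A symmetric random tensor of rank one that is `S`-subgaussian: `T = X ⊗ ⋯ ⊗ X` for some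
`S`-subgaussian random vector `X`. -/
def IsSymmRankOneSubgaussian {p d : ℕ} {Ω : Type*} [MeasurableSpace Ω]
    (S : Matrix (Fin d) (Fin d) ℝ) (T : Ω → Tensor p d) (μ : Measure Ω) : Prop :=
  ∃ X : Ω → EuclideanSpace ℝ (Fin d), IsSubgaussianVec S X μ ∧ ∀ ω, T ω = Tensor.power p (X ω)

/-- `σ₁`, where `σ₁²` is the largest eigenvalue of the positive-definite matrix `S`. -/
def sigmaOne {d : ℕ} {S : Matrix (Fin d) (Fin d) ℝ} (hS : S.PosDef) : ℝ :=
  Real.sqrt (⨆ i, hS.1.eigenvalues i)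

/-- The effective dimension `Tr S / σ₁²`. -/
def effDim {d : ℕ} {S : Matrix (Fin d) (Fin d) ℝ} (hS : S.PosDef) : ℝ :=
  S.trace / sigmaOne hS ^ 2

end

/-!
Write `N = ‖X‖` for a subgaussian vector `X`, `D` for the effective dimension and `σ` for `σ₁`.
Testing the subgaussian hypothesis against an independent Gaussian vector gives
`E exp (N ^ 2 / (8 * σ ^ 2)) ≤ 3 * exp (D / 2)`, with no union bound over directions. Let
`exp (-l)` be the failure probability aimed at. As `X ⊗ ⋯ ⊗ X` has Frobenius norm `N ^ p`, the
tensors can be truncated at Frobenius norm `(8 * σ ^ 2 * K) ^ (p / 2)` with `K` of order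
`(D + l) * log n`: with probability at least `1 - exp (-(l + 1))` no summand is affected, and the
truncation moves the mean only slightly. The truncated sum is controlled by a Hoeffding inequality
in the Hilbert space of tensors, obtained by following `E cosh (s * ‖Y₁ + ⋯ + Yₖ‖)` as `k` grows,
and the Frobenius norm dominates the operator norm.
-/

section Hoeffding

theorem convexOn_cosh_mul_sqrt (s : ℝ) :
    ConvexOn ℝ (Set.Ici 0) fun w : ℝ => Real.cosh (s * √w) := by
  have hasSum_cosh_mul_sqrt (w : ℝ) (hw : 0 ≤ w) :
      HasSum (fun k : ℕ => s ^ (2 * k) / (2 * k).factorial * w ^ k) (Real.cosh (s * √w)) := by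
    convert Real.hasSum_cosh (s * √w) using 2 with k
    rw [mul_pow, pow_mul √w, Real.sq_sqrt hw]
    ring
  refine ⟨convex_Ici 0, fun x (hx : 0 ≤ x) y (hy : 0 ≤ y) a b ha hb hab => ?_⟩
  simp only [smul_eq_mul]
  refine hasSum_le (fun k => ?_) (hasSum_cosh_mul_sqrt (a * x + b * y) (by positivity))
    (((hasSum_cosh_mul_sqrt x hx).mul_left a).add ((hasSum_cosh_mul_sqrt y hy).mul_left b))
  have coeff_nonneg : 0 ≤ s ^ (2 * k) / (2 * k).factorial := by
    rw [pow_mul]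
    positivity
  calc s ^ (2 * k) / (2 * k).factorial * (a * x + b * y) ^ k
      ≤ s ^ (2 * k) / (2 * k).factorial * (a * x ^ k + b * y ^ k) :=
        mul_le_mul_of_nonneg_left ((convexOn_pow k).2 hx hy ha hb hab) coeff_nonneg
    _ = _ := by ring

theorem cosh_mul_le_cosh_mul {a b : ℝ} (s : ℝ) (ha : 0 ≤ a) (hab : a ≤ b) :
    Real.cosh (s * a) ≤ Real.cosh (s * b) := by
  rw [Real.cosh_le_cosh, abs_mul, abs_mul]
  exact mul_le_mul_of_nonneg_left (abs_le_abs_of_nonneg ha hab) (abs_nonneg s)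

/- The left-hand side is a convex function of `t`, the right-hand side the affine function which
agrees with it at `t = ± a * b`; when `a * b = 0` the quotient is `0`. -/
theorem cosh_mul_sqrt_le (s : ℝ) {a b t : ℝ} (ha : 0 ≤ a) (hb : 0 ≤ b) (ht : |t| ≤ a * b) :
    Real.cosh (s * √(a ^ 2 + 2 * t + b ^ 2)) ≤
      Real.cosh (s * a) * Real.cosh (s * b) +
        Real.sinh (s * a) * Real.sinh (s * b) / (a * b) * t := by
  rcases (mul_nonneg ha hb).eq_or_lt with hab | hab
  · rw [← hab, abs_nonpos_iff] at ht
    rcases mul_eq_zero.1 hab.symm with rfl | rfl <;> simp [ht, Real.sqrt_sq, ha, hb]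
  · have ha' : a ≠ 0 := left_ne_zero_of_mul hab.ne'
    have hb' : b ≠ 0 := right_ne_zero_of_mul hab.ne'
    obtain ⟨neg_one_le, le_one⟩ : -1 ≤ t / (a * b) ∧ t / (a * b) ≤ 1 := by
      rw [← abs_le, abs_div, abs_of_pos hab]
      exact div_le_one_of_le₀ ht hab.le
    have convex_combination : (1 + t / (a * b)) / 2 * (a + b) ^ 2 +
        (1 - t / (a * b)) / 2 * (a - b) ^ 2 = a ^ 2 + 2 * t + b ^ 2 := by
      field_simp
      ring
    have jensen := (convexOn_cosh_mul_sqrt s).2 (Set.mem_Ici.2 (sq_nonneg (a + b)))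
      (Set.mem_Ici.2 (sq_nonneg (a - b)))
      (show 0 ≤ (1 + t / (a * b)) / 2 by linarith) (show 0 ≤ (1 - t / (a * b)) / 2 by linarith)
      (by ring)
    simp only [smul_eq_mul] at jensen
    have cosh_mul_abs (w : ℝ) : Real.cosh (s * |w|) = Real.cosh (s * w) := by
      rw [← Real.cosh_abs, abs_mul, abs_abs, ← abs_mul, Real.cosh_abs]
    rw [convex_combination, Real.sqrt_sq_eq_abs, Real.sqrt_sq_eq_abs, cosh_mul_abs, cosh_mul_abs,
      mul_add, mul_sub, Real.cosh_add, Real.cosh_sub] at jensen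
    exact jensen.trans_eq (by ring)

variable {E : Type*} [NormedAddCommGroup E] [InnerProductSpace ℝ E]

theorem cosh_norm_add_le (s : ℝ) (x : E) {y : E} {b : ℝ} (hy : ‖y‖ ≤ b) :
    Real.cosh (s * ‖x + y‖) ≤ Real.cosh (s * ‖x‖) * Real.cosh (s * b) +
      Real.sinh (s * ‖x‖) * Real.sinh (s * b) / (‖x‖ * b) * inner ℝ x y := by
  have inner_le : |inner ℝ x y| ≤ ‖x‖ * b :=
    (abs_real_inner_le_norm x y).trans (mul_le_mul_of_nonneg_left hy (norm_nonneg x))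
  refine le_trans (cosh_mul_le_cosh_mul s (norm_nonneg _) (Real.le_sqrt_of_sq_le ?_))
    (cosh_mul_sqrt_le s (norm_nonneg x) ((norm_nonneg y).trans hy) inner_le)
  rw [norm_add_sq_real]
  gcongr

variable [CompleteSpace E] [MeasurableSpace E] [BorelSpace E] [SecondCountableTopology E]

theorem lintegral_cosh_norm_add_le (ν : Measure E) [IsProbabilityMeasure ν] (s : ℝ) {b : ℝ}
    (hν : ∀ᵐ y ∂ν, ‖y‖ ≤ b) (h_center : ∫ y, y ∂ν = 0) (x : E) :
    ∫⁻ y, ENNReal.ofReal (Real.cosh (s * ‖x + y‖)) ∂ν ≤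
      ENNReal.ofReal (Real.cosh (s * ‖x‖)) * ENNReal.ofReal (Real.cosh (s * b)) := by
  set m := Real.sinh (s * ‖x‖) * Real.sinh (s * b) / (‖x‖ * b)
  have hid : Integrable (fun y : E => y) ν := Integrable.of_bound (by fun_prop) b hν
  have hlin : Integrable (fun y : E => m * inner ℝ x y) ν := (hid.const_inner x).const_mul m
  have hle : ∀ᵐ y ∂ν, Real.cosh (s * ‖x + y‖) ≤
      Real.cosh (s * ‖x‖) * Real.cosh (s * b) + m * inner ℝ x y := by
    filter_upwards [hν] with y hy using cosh_norm_add_le s x hy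
  have integral_linear_eq_zero : ∫ y, m * inner ℝ x y ∂ν = 0 := by
    rw [integral_const_mul, integral_inner hid, h_center, inner_zero_right, mul_zero]
  calc ∫⁻ y, ENNReal.ofReal (Real.cosh (s * ‖x + y‖)) ∂ν
      ≤ ∫⁻ y, ENNReal.ofReal
          (Real.cosh (s * ‖x‖) * Real.cosh (s * b) + m * inner ℝ x y) ∂ν :=
        lintegral_mono_ae (hle.mono fun _ => ENNReal.ofReal_le_ofReal)
    _ = ENNReal.ofReal (∫ y, (Real.cosh (s * ‖x‖) * Real.cosh (s * b) + m * inner ℝ x y) ∂ν) :=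
        (ofReal_integral_eq_lintegral_ofReal ((integrable_const _).add hlin)
          (hle.mono fun _ => (Real.cosh_pos _).le.trans)).symm
    _ = ENNReal.ofReal (Real.cosh (s * ‖x‖)) * ENNReal.ofReal (Real.cosh (s * b)) := by
        rw [integral_add (integrable_const _) hlin, integral_linear_eq_zero]
        simp [ENNReal.ofReal_mul (Real.cosh_pos _).le]

variable {Ω ι : Type*} [MeasurableSpace Ω] {μ : Measure Ω} [IsProbabilityMeasure μ]

theorem lintegral_cosh_norm_add_le_of_indepFun {U V : Ω → E} (hU : AEMeasurable U μ)
    (hV : AEMeasurable V μ) (hUV : IndepFun U V μ) (s : ℝ) {b : ℝ} (hb : ∀ᵐ ω ∂μ, ‖V ω‖ ≤ b)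
    (h_center : ∫ ω, V ω ∂μ = 0) :
    ∫⁻ ω, ENNReal.ofReal (Real.cosh (s * ‖U ω + V ω‖)) ∂μ ≤
      (∫⁻ ω, ENNReal.ofReal (Real.cosh (s * ‖U ω‖)) ∂μ) * ENNReal.ofReal (Real.cosh (s * b)) := by
  have := Measure.isProbabilityMeasure_map hU
  have := Measure.isProbabilityMeasure_map hV
  have hbV : ∀ᵐ y ∂(μ.map V), ‖y‖ ≤ b := by
    rwa [ae_map_iff hV (measurableSet_le measurable_norm measurable_const)]
  have h_centerV : ∫ y, y ∂(μ.map V) = 0 := by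
    rwa [integral_map hV (by fun_prop)]
  have cosh_measurable : Measurable fun z : E × E => ENNReal.ofReal (Real.cosh (s * ‖z.1 + z.2‖)) :=
    (Real.continuous_cosh.measurable.comp (by fun_prop)).ennreal_ofReal
  have cosh_measurable' : Measurable fun x : E => ENNReal.ofReal (Real.cosh (s * ‖x‖)) :=
    (Real.continuous_cosh.measurable.comp (by fun_prop)).ennreal_ofReal
  calc ∫⁻ ω, ENNReal.ofReal (Real.cosh (s * ‖U ω + V ω‖)) ∂μ
      = ∫⁻ z, ENNReal.ofReal (Real.cosh (s * ‖z.1 + z.2‖)) ∂(μ.map fun ω => (U ω, V ω)) :=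
        (lintegral_map' cosh_measurable.aemeasurable (hU.prodMk hV)).symm
    _ = ∫⁻ x, ∫⁻ y, ENNReal.ofReal (Real.cosh (s * ‖x + y‖)) ∂(μ.map V) ∂(μ.map U) := by
        rw [(indepFun_iff_map_prod_eq_prod_map_map hU hV).1 hUV,
          lintegral_prod _ cosh_measurable.aemeasurable]
    _ ≤ ∫⁻ x, ENNReal.ofReal (Real.cosh (s * ‖x‖)) * ENNReal.ofReal (Real.cosh (s * b))
          ∂(μ.map U) :=
        lintegral_mono fun x => lintegral_cosh_norm_add_le _ s hbV h_centerV x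
    _ = _ := by
        rw [lintegral_mul_const' _ _ ENNReal.ofReal_ne_top,
          lintegral_map' cosh_measurable'.aemeasurable hU]

theorem lintegral_cosh_norm_sum_le {Y : ι → Ω → E} (hY : ∀ i, AEMeasurable (Y i) μ)
    (h_indep : iIndepFun Y μ) (s : ℝ) {b : ℝ} (hb : ∀ i, ∀ᵐ ω ∂μ, ‖Y i ω‖ ≤ b)
    (h_center : ∀ i, ∫ ω, Y i ω ∂μ = 0) (t : Finset ι) :
    ∫⁻ ω, ENNReal.ofReal (Real.cosh (s * ‖∑ i ∈ t, Y i ω‖)) ∂μ ≤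
      ENNReal.ofReal (Real.cosh (s * b)) ^ t.card := by
  classical
  induction t using Finset.induction_on with
  | empty => simp
  | insert i t hi ih =>
    have indep_sum : IndepFun (fun ω => ∑ j ∈ t, Y j ω) (Y i) μ := by
      simpa only [Finset.sum_fn] using h_indep.indepFun_finsetSum_of_notMem₀ hY hi
    have peel := lintegral_cosh_norm_add_le_of_indepFun (by fun_prop) (hY i) indep_sum s (hb i)
      (h_center i)
    simp only [Finset.sum_insert hi, Finset.card_insert_of_notMem hi, pow_succ, add_comm (Y i _)]
    exact peel.trans (mul_le_mul_left ih _)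

theorem measureReal_le_norm_sum_le [Fintype ι] {Y : ι → Ω → E}
    (hY : ∀ i, AEMeasurable (Y i) μ) (h_indep : iIndepFun Y μ) {b r : ℝ}
    (hb : ∀ i, ∀ᵐ ω ∂μ, ‖Y i ω‖ ≤ b) (h_center : ∀ i, ∫ ω, Y i ω ∂μ = 0) (hr : 0 ≤ r) :
    μ.real {ω | r ≤ ‖∑ i, Y i ω‖} ≤ 2 * Real.exp (-(r ^ 2 / (2 * (Fintype.card ι * b ^ 2)))) := by
  set v := Fintype.card ι * b ^ 2 with hv
  set s := r / v with hs
  have optimal_exponent : -(r ^ 2 / (2 * v)) = v * s ^ 2 / 2 - s * r := by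
    rcases eq_or_ne v 0 with h | h
    · simp [hs, h]
    · rw [hs]
      field_simp
      ring
  have chebyshev : ENNReal.ofReal (Real.cosh (s * r)) * μ {ω | r ≤ ‖∑ i, Y i ω‖} ≤
      ∫⁻ ω, ENNReal.ofReal (Real.cosh (s * ‖∑ i, Y i ω‖)) ∂μ := by
    refine le_trans (mul_le_mul_right (measure_mono fun ω (hω : r ≤ _) => ?_) _)
      (mul_meas_ge_le_lintegral₀ ?_ _)
    · exact ENNReal.ofReal_le_ofReal (cosh_mul_le_cosh_mul s hr hω)
    · have : AEMeasurable (fun ω => ∑ i, Y i ω) μ := by fun_prop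
      exact (Real.continuous_cosh.measurable.comp_aemeasurable
        (this.norm.const_mul s)).ennreal_ofReal
  have cosh_pow_le : Real.cosh (s * b) ^ Fintype.card ι ≤ Real.exp (v * s ^ 2 / 2) := by
    refine (pow_le_pow_left₀ (Real.cosh_pos _).le (Real.cosh_le_exp_half_sq _) _).trans_eq ?_
    rw [← Real.exp_nat_mul, hv]
    ring_nf
  have markov : Real.cosh (s * r) * μ.real {ω | r ≤ ‖∑ i, Y i ω‖} ≤
      Real.cosh (s * b) ^ Fintype.card ι := by
    have h := chebyshev.trans (lintegral_cosh_norm_sum_le hY h_indep s hb h_center Finset.univ)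
    rwa [← ofReal_measureReal, ← ENNReal.ofReal_mul (Real.cosh_pos _).le,
      ← ENNReal.ofReal_pow (Real.cosh_pos _).le,
      ENNReal.ofReal_le_ofReal_iff (pow_nonneg (Real.cosh_pos _).le _)] at h
  have half_exp_le : Real.exp (s * r) / 2 ≤ Real.cosh (s * r) := by
    rw [Real.cosh_eq]
    linarith [Real.exp_pos (-(s * r))]
  rw [optimal_exponent, Real.exp_sub, ← mul_div_assoc, le_div_iff₀ (Real.exp_pos _)]
  linarith [mul_le_mul_of_nonneg_right half_exp_le (measureReal_nonneg (μ := μ)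
    (s := {ω | r ≤ ‖∑ i, Y i ω‖}))]

end Hoeffding

section ExponentialMoments

variable {Ω : Type*} [MeasurableSpace Ω] {μ : Measure Ω}

theorem lintegral_ofReal_le_of_tail_le_rpow [IsProbabilityMeasure μ] {f : Ω → ℝ}
    (hf : AEMeasurable f μ) (hf_nonneg : 0 ≤ᵐ[μ] f) {C a : ℝ} (hC : 0 ≤ C) (ha : 1 < a)
    (h_tail : ∀ t, 1 < t → μ.real {ω | t < f ω} ≤ C * t ^ (-a)) :
    ∫⁻ ω, ENNReal.ofReal (f ω) ∂μ ≤ 1 + ENNReal.ofReal (C / (a - 1)) := by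
  rw [lintegral_eq_lintegral_meas_lt μ hf_nonneg hf, ← Set.Ioc_union_Ioi_eq_Ioi zero_le_one,
    lintegral_union measurableSet_Ioi (Set.Ioc_disjoint_Ioi le_rfl)]
  have rpow_integrable : IntegrableOn (fun t : ℝ => C * t ^ (-a)) (Set.Ioi 1) :=
    (integrableOn_Ioi_rpow_of_lt (by linarith) one_pos).const_mul C
  refine add_le_add ?_ ?_
  · calc ∫⁻ t in Set.Ioc (0 : ℝ) 1, μ {ω | t < f ω}
        ≤ ∫⁻ _ in Set.Ioc (0 : ℝ) 1, 1 := lintegral_mono fun t => prob_le_one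
      _ = 1 := by simp
  · calc ∫⁻ t in Set.Ioi (1 : ℝ), μ {ω | t < f ω}
        ≤ ∫⁻ t in Set.Ioi (1 : ℝ), ENNReal.ofReal (C * t ^ (-a)) := by
          refine setLIntegral_mono' measurableSet_Ioi fun t ht => ?_
          rw [← ofReal_measureReal]
          exact ENNReal.ofReal_le_ofReal (h_tail t ht)
      _ = ENNReal.ofReal (∫ t in Set.Ioi (1 : ℝ), C * t ^ (-a)) := by
          refine (ofReal_integral_eq_lintegral_ofReal rpow_integrable ?_).symm
          filter_upwards [ae_restrict_mem measurableSet_Ioi] with t ht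
          exact mul_nonneg hC (Real.rpow_nonneg (zero_le_one.trans ht.le) _)
      _ = ENNReal.ofReal (C / (a - 1)) := by
          rw [integral_const_mul, integral_Ioi_rpow_of_lt (by linarith) one_pos, Real.one_rpow,
            neg_div, ← div_neg, neg_add_eq_sub, neg_sub, mul_one_div]

theorem lintegral_exp_sq_le_of_tail_le_exp [IsProbabilityMeasure μ] {Z : Ω → ℝ}
    (hZ : AEMeasurable Z μ) {v : ℝ} (hv : 0 < v)
    (h_tail : ∀ t, 0 < t → μ.real {ω | t < |Z ω|} ≤ 2 * Real.exp (-(1 / 2) * (t ^ 2 / v))) :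
    ∫⁻ ω, ENNReal.ofReal (Real.exp (Z ω ^ 2 / (4 * v))) ∂μ ≤ 3 := by
  refine (lintegral_ofReal_le_of_tail_le_rpow (C := 2) (a := 2) (by fun_prop)
    (.of_forall fun ω => (Real.exp_pos _).le) zero_le_two one_lt_two fun t ht => ?_).trans_eq
    (by norm_num)
  have ht0 : 0 < t := one_pos.trans ht
  have log_pos : 0 < Real.log t := Real.log_pos ht
  convert h_tail √(4 * v * Real.log t) (Real.sqrt_pos.2 (by positivity)) using 3
  · ext ω
    rw [← Real.log_lt_iff_lt_exp ht0, lt_div_iff₀ (by positivity), ← Real.sqrt_sq_eq_abs,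
      Real.sqrt_lt_sqrt_iff (by positivity), mul_comm]
  · rw [Real.rpow_def_of_pos ht0, Real.sq_sqrt (by positivity)]
    congr 1
    field_simp
    ring

theorem lintegral_exp_le_of_tail_le_exp [IsProbabilityMeasure μ] {Z : Ω → ℝ}
    (hZ : AEMeasurable Z μ) {v : ℝ} (hv : 0 < v)
    (h_tail : ∀ t, 0 < t → μ.real {ω | t < |Z ω|} ≤ 2 * Real.exp (-(1 / 2) * (t ^ 2 / v))) :
    ∫⁻ ω, ENNReal.ofReal (Real.exp (Z ω)) ∂μ ≤ 3 * ENNReal.ofReal (Real.exp v) := by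
  have le_sq_div_add (z : ℝ) : z ≤ z ^ 2 / (4 * v) + v := by
    have h : z ^ 2 / (4 * v) + v - z = (z - 2 * v) ^ 2 / (4 * v) := by
      field_simp
      ring
    exact sub_nonneg.1 (h ▸ by positivity)
  calc ∫⁻ ω, ENNReal.ofReal (Real.exp (Z ω)) ∂μ
      ≤ ∫⁻ ω, ENNReal.ofReal (Real.exp (Z ω ^ 2 / (4 * v))) * ENNReal.ofReal (Real.exp v) ∂μ := by
        refine lintegral_mono fun ω => ?_
        rw [← ENNReal.ofReal_mul (Real.exp_pos _).le, ← Real.exp_add]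
        exact ENNReal.ofReal_le_ofReal (Real.exp_le_exp.2 (le_sq_div_add _))
    _ ≤ 3 * ENNReal.ofReal (Real.exp v) := by
        rw [lintegral_mul_const' _ _ ENNReal.ofReal_ne_top]
        exact mul_le_mul_left (lintegral_exp_sq_le_of_tail_le_exp hZ hv h_tail) _

theorem IsSubgaussianVec.lintegral_exp_inner_le [IsProbabilityMeasure μ] {d : ℕ}
    {S : Matrix (Fin d) (Fin d) ℝ} (hS : S.PosDef) {X : Ω → EuclideanSpace ℝ (Fin d)}
    (hX : IsSubgaussianVec S X μ) (u : EuclideanSpace ℝ (Fin d)) :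
    ∫⁻ ω, ENNReal.ofReal (Real.exp (inner ℝ (X ω) u)) ∂μ ≤
      3 * ENNReal.ofReal (Real.exp (u.ofLp ⬝ᵥ (S *ᵥ u.ofLp))) := by
  rcases eq_or_ne u 0 with rfl | hu
  · simp
  · have quad_pos : 0 < u.ofLp ⬝ᵥ (S *ᵥ u.ofLp) := by
      simpa using hS.dotProduct_mulVec_pos (x := u.ofLp) (by simpa using hu)
    have norm_pos : 0 < ‖u‖ := norm_pos_iff.2 hu
    refine lintegral_exp_le_of_tail_le_exp (hX.1.inner_const).aemeasurable quad_pos fun t ht => ?_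
    convert hX.2 (‖u‖⁻¹ * t) (by positivity) (‖u‖⁻¹ • u) (by simp [norm_smul, norm_pos.ne'])
      using 3
    · ext ω
      rw [inner_smul_right, abs_mul, abs_of_pos (inv_pos.2 norm_pos),
        mul_lt_mul_iff_right₀ (inv_pos.2 norm_pos)]
    · simp only [WithLp.ofLp_smul, Matrix.mulVec_smul, dotProduct_smul, smul_dotProduct,
        smul_eq_mul]
      field_simp

end ExponentialMoments

section Gaussian

theorem gaussianPDFReal_mul_exp_sq (a x : ℝ) :
    gaussianPDFReal 0 1 x * Real.exp (a * x ^ 2) =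
      (√(2 * Real.pi))⁻¹ * Real.exp (-(1 / 2 - a) * x ^ 2) := by
  rw [gaussianPDFReal, mul_assoc, ← Real.exp_add]
  simp only [NNReal.coe_one, sub_zero, mul_one]
  ring_nf

theorem integrable_exp_sq_gaussianReal {a : ℝ} (ha : a < 1 / 2) :
    Integrable (fun x => Real.exp (a * x ^ 2)) (gaussianReal 0 1) := by
  rw [gaussianReal_of_var_ne_zero _ one_ne_zero, gaussianPDF_def,
    integrable_withDensity_iff_integrable_smul₀' (by fun_prop) (by simp)]
  simp only [ENNReal.toReal_ofReal (gaussianPDFReal_nonneg _ _ _), smul_eq_mul,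
    gaussianPDFReal_mul_exp_sq]
  exact (integrable_exp_neg_mul_sq (by linarith)).const_mul _

theorem integral_exp_sq_gaussianReal {a : ℝ} (ha : a < 1 / 2) :
    ∫ x, Real.exp (a * x ^ 2) ∂(gaussianReal 0 1) = (√(1 - 2 * a))⁻¹ := by
  have h : 1 - 2 * a ≠ 0 := by linarith
  rw [integral_gaussianReal_eq_integral_smul one_ne_zero]
  simp only [smul_eq_mul, gaussianPDFReal_mul_exp_sq]
  rw [integral_const_mul, integral_gaussian, ← Real.sqrt_inv, ← Real.sqrt_mul (by positivity),
    ← Real.sqrt_inv]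
  congr 1
  have := Real.pi_ne_zero
  field_simp

theorem integral_exp_sq_gaussianReal_le {a : ℝ} (ha_nonneg : 0 ≤ a) (ha : a ≤ 1 / 4) :
    ∫ x, Real.exp (a * x ^ 2) ∂(gaussianReal 0 1) ≤ Real.exp (2 * a) := by
  rw [integral_exp_sq_gaussianReal (by linarith), ← Real.sqrt_inv,
    Real.sqrt_le_left (Real.exp_pos _).le, ← Real.exp_nat_mul,
    inv_le_iff_one_le_mul₀ (by linarith)]
  have := Real.add_one_le_exp ((2 : ℕ) * (2 * a))
  push_cast at this ⊢
  nlinarith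

theorem lintegral_pi_prod_ofReal {ι : Type*} [Fintype ι] {γ : ι → Measure ℝ}
    [∀ i, SigmaFinite (γ i)] {f : ι → ℝ → ℝ} (hf : ∀ i, Integrable (f i) (γ i))
    (hf_nonneg : ∀ i x, 0 ≤ f i x) :
    ∫⁻ x, ENNReal.ofReal (∏ i, f i (x i)) ∂(Measure.pi γ) =
      ENNReal.ofReal (∏ i, ∫ x, f i x ∂(γ i)) := by
  rw [← ofReal_integral_eq_lintegral_ofReal (Integrable.fintype_prod hf)
    (.of_forall fun x => Finset.prod_nonneg fun i _ => hf_nonneg i _),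
    integral_fintype_prod_eq_prod]

variable {E : Type*} [NormedAddCommGroup E] [InnerProductSpace ℝ E] [FiniteDimensional ℝ E]
  [MeasurableSpace E] [BorelSpace E]

theorem map_inner_stdGaussian (x : E) :
    (stdGaussian E).map (fun g => inner ℝ x g) = gaussianReal 0 (‖x‖₊ ^ 2) := by
  have h := IsGaussian.map_eq_gaussianReal (μ := stdGaussian E) (innerSL ℝ x)
  rw [integral_strongDual_stdGaussian, variance_dual_stdGaussian, innerSL_apply_norm] at h
  rw [Real.toNNReal_pow (norm_nonneg x), norm_toNNReal] at h
  exact h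

theorem lintegral_exp_inner_stdGaussian (x : E) :
    ∫⁻ g, ENNReal.ofReal (Real.exp (inner ℝ x g)) ∂(stdGaussian E) =
      ENNReal.ofReal (Real.exp (‖x‖ ^ 2 / 2)) := by
  have mgf_eq := congrFun (mgf_id_gaussianReal (μ := 0) (v := ‖x‖₊ ^ 2)) 1
  have exp_measurable : Measurable fun y : ℝ => ENNReal.ofReal (Real.exp y) := by fun_prop
  calc ∫⁻ g, ENNReal.ofReal (Real.exp (inner ℝ x g)) ∂(stdGaussian E)
      = ∫⁻ y, ENNReal.ofReal (Real.exp y) ∂((stdGaussian E).map fun g => inner ℝ x g) :=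
        (lintegral_map exp_measurable (by fun_prop)).symm
    _ = ∫⁻ y, ENNReal.ofReal (Real.exp y) ∂(gaussianReal 0 (‖x‖₊ ^ 2)) := by
        rw [map_inner_stdGaussian]
    _ = ENNReal.ofReal (∫ y, Real.exp y ∂(gaussianReal 0 (‖x‖₊ ^ 2))) :=
        (ofReal_integral_eq_lintegral_ofReal (by simpa using integrable_exp_mul_gaussianReal 1)
          (.of_forall fun _ => (Real.exp_pos _).le)).symm
    _ = ENNReal.ofReal (Real.exp (‖x‖ ^ 2 / 2)) := by
        rw [show ∫ y, Real.exp y ∂(gaussianReal 0 (‖x‖₊ ^ 2)) = Real.exp (‖x‖ ^ 2 / 2) by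
          simpa [mgf] using mgf_eq]

variable {ι : Type*} [Fintype ι]

theorem lintegral_exp_sum_sq_stdGaussian_le (v : OrthonormalBasis ι ℝ E) {a : ι → ℝ}
    (ha_nonneg : ∀ i, 0 ≤ a i) (ha : ∀ i, a i ≤ 1 / 4) :
    ∫⁻ g, ENNReal.ofReal (Real.exp (∑ i, a i * inner ℝ (v i) g ^ 2)) ∂(stdGaussian E) ≤
      ENNReal.ofReal (Real.exp (2 * ∑ i, a i)) := by
  have inner_sum_smul (x : ι → ℝ) (i : ι) : inner ℝ (v i) (∑ j, x j • v j) = x i :=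
    v.orthonormal.inner_right_fintype x i
  rw [stdGaussian_eq_map_pi_orthonormalBasis v, lintegral_map (by fun_prop) (by fun_prop)]
  simp_rw [inner_sum_smul, Real.exp_sum]
  rw [lintegral_pi_prod_ofReal (f := fun i x => Real.exp (a i * x ^ 2))
    (fun i => integrable_exp_sq_gaussianReal (by linarith [ha i]))
    (fun _ _ => (Real.exp_pos _).le), Finset.mul_sum, Real.exp_sum]
  exact ENNReal.ofReal_le_ofReal (Finset.prod_le_prod
    (fun i _ => integral_nonneg fun _ => (Real.exp_pos _).le)
    fun i _ => integral_exp_sq_gaussianReal_le (ha_nonneg i) (ha i))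

/- Gaussian decoupling: `exp (‖x‖ ^ 2 / (8 * s ^ 2))` is the mean of `exp ⟪x, g / (2 * s)⟫` over a
standard Gaussian `g`, so by Tonelli the hypothesis may be applied at `u = g / (2 * s)`. -/
theorem lintegral_exp_norm_sq_le_of_lintegral_exp_inner_le {Ω : Type*} [MeasurableSpace Ω]
    {μ : Measure Ω} [SFinite μ] {X : Ω → E} (hX : Measurable X) (v : OrthonormalBasis ι ℝ E)
    {lam : ι → ℝ} {s : ℝ} (hs : 0 < s) (hlam_nonneg : ∀ i, 0 ≤ lam i)
    (hlam : ∀ i, lam i ≤ s ^ 2) {A : ENNReal} (hA : A ≠ ⊤)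
    (h_exp : ∀ u, ∫⁻ ω, ENNReal.ofReal (Real.exp (inner ℝ (X ω) u)) ∂μ ≤
      A * ENNReal.ofReal (Real.exp (∑ i, lam i * inner ℝ (v i) u ^ 2))) :
    ∫⁻ ω, ENNReal.ofReal (Real.exp (‖X ω‖ ^ 2 / (8 * s ^ 2))) ∂μ ≤
      A * ENNReal.ofReal (Real.exp ((∑ i, lam i) / s ^ 2 / 2)) := by
  have norm_sq_eq (x : E) : ‖x‖ ^ 2 / (8 * s ^ 2) = ‖(2 * s)⁻¹ • x‖ ^ 2 / 2 := by
    rw [norm_smul, mul_pow, Real.norm_of_nonneg (by positivity)]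
    field_simp
    norm_num
  have jointly_measurable : Measurable fun z : Ω × E =>
      ENNReal.ofReal (Real.exp (inner ℝ (X z.1) ((2 * s)⁻¹ • z.2))) := by
    fun_prop
  calc ∫⁻ ω, ENNReal.ofReal (Real.exp (‖X ω‖ ^ 2 / (8 * s ^ 2))) ∂μ
      = ∫⁻ ω, ∫⁻ g, ENNReal.ofReal (Real.exp (inner ℝ (X ω) ((2 * s)⁻¹ • g)))
          ∂(stdGaussian E) ∂μ := by
        simp_rw [norm_sq_eq, ← lintegral_exp_inner_stdGaussian, real_inner_smul_left,
          real_inner_smul_right]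
    _ = ∫⁻ g, ∫⁻ ω, ENNReal.ofReal (Real.exp (inner ℝ (X ω) ((2 * s)⁻¹ • g))) ∂μ
          ∂(stdGaussian E) := lintegral_lintegral_swap jointly_measurable.aemeasurable
    _ ≤ ∫⁻ g, A * ENNReal.ofReal (Real.exp (∑ i, lam i * inner ℝ (v i) ((2 * s)⁻¹ • g) ^ 2))
          ∂(stdGaussian E) := lintegral_mono fun g => h_exp _
    _ = A * ∫⁻ g, ENNReal.ofReal (Real.exp (∑ i, lam i / (4 * s ^ 2) * inner ℝ (v i) g ^ 2))
          ∂(stdGaussian E) := by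
        rw [lintegral_const_mul' _ _ hA]
        simp_rw [real_inner_smul_right]
        congr! 6 with g i
        ring
    _ ≤ A * ENNReal.ofReal (Real.exp (2 * ∑ i, lam i / (4 * s ^ 2))) := by
        refine mul_le_mul_right (lintegral_exp_sum_sq_stdGaussian_le v
          (fun i => div_nonneg (hlam_nonneg i) (by positivity)) fun i => ?_) _
        rw [div_le_div_iff₀ (by positivity) (by positivity)]
        linarith [hlam i]
    _ = A * ENNReal.ofReal (Real.exp ((∑ i, lam i) / s ^ 2 / 2)) := by
        rw [← Finset.sum_div]
        ring_nf

end Gaussian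

section PosDef

theorem dotProduct_mulVec_eq_sum_eigenvalues {ι : Type*} [Fintype ι] [DecidableEq ι]
    {S : Matrix ι ι ℝ} (hS : S.IsHermitian) (x : EuclideanSpace ℝ ι) :
    x.ofLp ⬝ᵥ (S *ᵥ x.ofLp) = ∑ i, hS.eigenvalues i * inner ℝ (hS.eigenvectorBasis i) x ^ 2 := by
  set v := hS.eigenvectorBasis with hv
  have mulVec_eq : S *ᵥ x.ofLp = (∑ i, (inner ℝ (v i) x * hS.eigenvalues i) • v i).ofLp := by
    conv_lhs => rw [← v.sum_repr' x]
    simp only [WithLp.ofLp_sum, WithLp.ofLp_smul, Matrix.mulVec_sum, Matrix.mulVec_smul, hv,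
      hS.mulVec_eigenvectorBasis, smul_smul]
  have dotProduct_eq_inner (a b : EuclideanSpace ℝ ι) : a.ofLp ⬝ᵥ b.ofLp = inner ℝ a b := by
    rw [EuclideanSpace.inner_eq_star_dotProduct, star_trivial, dotProduct_comm]
  rw [mulVec_eq, dotProduct_eq_inner, inner_sum]
  refine Finset.sum_congr rfl fun i _ => ?_
  rw [real_inner_smul_right, real_inner_comm]
  ring

variable {d : ℕ} {S : Matrix (Fin d) (Fin d) ℝ}

theorem sigmaOne_sq (hS : S.PosDef) : sigmaOne hS ^ 2 = ⨆ i, hS.1.eigenvalues i :=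
  Real.sq_sqrt (Real.iSup_nonneg fun i => (hS.eigenvalues_pos i).le)

theorem eigenvalues_le_sigmaOne_sq (hS : S.PosDef) (i : Fin d) :
    hS.1.eigenvalues i ≤ sigmaOne hS ^ 2 := by
  rw [sigmaOne_sq]
  exact le_ciSup (Set.finite_range _).bddAbove i

theorem sigmaOne_pos (hd : 1 ≤ d) (hS : S.PosDef) : 0 < sigmaOne hS :=
  Real.sqrt_pos.2 <| sigmaOne_sq hS ▸
    (hS.eigenvalues_pos ⟨0, hd⟩).trans_le (eigenvalues_le_sigmaOne_sq hS ⟨0, hd⟩)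

theorem effDim_eq_sum_eigenvalues_div (hS : S.PosDef) :
    effDim hS = (∑ i, hS.1.eigenvalues i) / sigmaOne hS ^ 2 := by
  simp [effDim, hS.1.trace_eq_sum_eigenvalues]

theorem one_le_effDim (hd : 1 ≤ d) (hS : S.PosDef) : 1 ≤ effDim hS := by
  have : Nonempty (Fin d) := ⟨⟨0, hd⟩⟩
  rw [effDim_eq_sum_eigenvalues_div, one_le_div (pow_pos (sigmaOne_pos hd hS) 2), sigmaOne_sq]
  exact ciSup_le fun i => Finset.single_le_sum (f := hS.1.eigenvalues)
    (fun j _ => (hS.eigenvalues_pos j).le) (Finset.mem_univ i)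

variable {Ω : Type*} [MeasurableSpace Ω] {μ : Measure Ω} [IsProbabilityMeasure μ]
  {X : Ω → EuclideanSpace ℝ (Fin d)}

theorem IsSubgaussianVec.lintegral_exp_norm_sq_le (hd : 1 ≤ d) (hS : S.PosDef)
    (hX : IsSubgaussianVec S X μ) :
    ∫⁻ ω, ENNReal.ofReal (Real.exp (‖X ω‖ ^ 2 / (8 * sigmaOne hS ^ 2))) ∂μ ≤
      ENNReal.ofReal (3 * Real.exp (effDim hS / 2)) := by
  rw [effDim_eq_sum_eigenvalues_div, ENNReal.ofReal_mul zero_le_three, ENNReal.ofReal_ofNat]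
  refine lintegral_exp_norm_sq_le_of_lintegral_exp_inner_le hX.1 hS.1.eigenvectorBasis
    (sigmaOne_pos hd hS) (fun i => (hS.eigenvalues_pos i).le) (eigenvalues_le_sigmaOne_sq hS)
    ENNReal.ofNat_ne_top fun u => ?_
  rw [← dotProduct_mulVec_eq_sum_eigenvalues]
  exact hX.lintegral_exp_inner_le hS u

theorem IsSubgaussianVec.integrable_exp_norm_sq (hd : 1 ≤ d) (hS : S.PosDef)
    (hX : IsSubgaussianVec S X μ) :
    Integrable (fun ω => Real.exp (‖X ω‖ ^ 2 / (8 * sigmaOne hS ^ 2))) μ := by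
  have hX_meas := hX.1
  refine ⟨by fun_prop, ?_⟩
  rw [hasFiniteIntegral_iff_ofReal (.of_forall fun _ => (Real.exp_pos _).le)]
  exact (hX.lintegral_exp_norm_sq_le hd hS).trans_lt ENNReal.ofReal_lt_top

theorem IsSubgaussianVec.integral_exp_norm_sq_le (hd : 1 ≤ d) (hS : S.PosDef)
    (hX : IsSubgaussianVec S X μ) :
    ∫ ω, Real.exp (‖X ω‖ ^ 2 / (8 * sigmaOne hS ^ 2)) ∂μ ≤ 3 * Real.exp (effDim hS / 2) := by
  rw [integral_eq_lintegral_of_nonneg_ae (.of_forall fun _ => (Real.exp_pos _).le)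
    (hX.integrable_exp_norm_sq hd hS).1]
  exact ENNReal.toReal_le_of_le_ofReal (by positivity) (hX.lintegral_exp_norm_sq_le hd hS)

end PosDef

section Tail

theorem pow_le_of_sqrt_lt {c K x : ℝ} (hc : 0 < c) (hK : 1 ≤ K) (hx : √(c * K) < x) (p : ℕ) :
    x ^ p ≤ √(c * K) ^ p * p.factorial * Real.exp (1 - K) * Real.exp (x ^ 2 / c) := by
  have x_nonneg : 0 ≤ x := (Real.sqrt_nonneg _).trans hx.le
  have sqrt_sq : √(c * K) ^ 2 = c * K := Real.sq_sqrt (by positivity)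
  obtain ⟨u, hu⟩ : ∃ u, x ^ 2 / c = K + u := ⟨x ^ 2 / c - K, by ring⟩
  have u_nonneg : 0 ≤ u := by
    have : K < x ^ 2 / c := (lt_div_iff₀' hc).2 (Real.lt_sq_of_sqrt_lt hx)
    linarith
  have x_le : x ≤ √(c * K) * (1 + u) := by
    refine (pow_le_pow_iff_left₀ x_nonneg (by positivity) two_ne_zero).1 ?_
    rw [mul_pow, sqrt_sq, mul_assoc, (div_eq_iff hc.ne').1 hu, mul_comm _ c]
    refine mul_le_mul_of_nonneg_left ?_ hc.le
    nlinarith [mul_nonneg u_nonneg (sub_nonneg.2 hK),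
      mul_nonneg (sq_nonneg u) (zero_le_one.trans hK)]
  calc x ^ p ≤ √(c * K) ^ p * (1 + u) ^ p := by
        rw [← mul_pow]
        exact pow_le_pow_left₀ x_nonneg x_le p
    _ ≤ √(c * K) ^ p * (p.factorial * Real.exp (1 + u)) := by
        have := Real.pow_div_factorial_le_exp (1 + u) (by linarith) p
        gcongr
        rwa [div_le_iff₀' (by positivity)] at this
    _ = √(c * K) ^ p * p.factorial * Real.exp (1 - K) * Real.exp (x ^ 2 / c) := by
        rw [mul_assoc _ (Real.exp _), ← Real.exp_add, hu, mul_assoc]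
        ring_nf

variable {Ω : Type*} [MeasurableSpace Ω] {μ : Measure Ω} {N : Ω → ℝ} {c K : ℝ}

theorem integrable_pow_of_integrable_exp_sq (hN : AEStronglyMeasurable N μ) (hc : 0 < c)
    (h_int : Integrable (fun ω => Real.exp (N ω ^ 2 / c)) μ) (p : ℕ) :
    Integrable (fun ω => N ω ^ p) μ := by
  have abs_le (x : ℝ) : |x| ≤ x ^ 2 / c + c / 4 := by
    have : x ^ 2 / c + c / 4 - |x| = (|x| - c / 2) ^ 2 / c := by
      rw [sub_sq, sq_abs]
      field_simp
      ring
    exact sub_nonneg.1 (this ▸ by positivity)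
  refine (h_int.mul_const (p.factorial * Real.exp (c / 4))).mono' (hN.pow p)
    (.of_forall fun ω => ?_)
  have := Real.pow_div_factorial_le_exp |N ω| (abs_nonneg _) p
  rw [div_le_iff₀' (by positivity)] at this
  calc ‖N ω ^ p‖ = |N ω| ^ p := by rw [norm_pow, Real.norm_eq_abs]
    _ ≤ p.factorial * Real.exp |N ω| := this
    _ ≤ p.factorial * Real.exp (N ω ^ 2 / c + c / 4) := by gcongr; exact abs_le _
    _ = Real.exp (N ω ^ 2 / c) * (p.factorial * Real.exp (c / 4)) := by
        rw [Real.exp_add]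
        ring

theorem measureReal_sqrt_lt_le [IsFiniteMeasure μ] (hc : 0 < c)
    (h_int : Integrable (fun ω => Real.exp (N ω ^ 2 / c)) μ) :
    μ.real {ω | √(c * K) < N ω} ≤ Real.exp (-K) * ∫ ω, Real.exp (N ω ^ 2 / c) ∂μ := by
  have chernoff := measure_ge_le_exp_mul_mgf (X := fun ω => N ω ^ 2 / c) K zero_le_one
    (by simpa only [one_mul] using h_int)
  simp only [mgf, one_mul, neg_mul] at chernoff
  refine (measureReal_mono fun ω (hω : √(c * K) < N ω) => ?_).trans chernoff
  exact (le_div_iff₀' hc).2 (Real.lt_sq_of_sqrt_lt hω).le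

theorem setIntegral_pow_le_of_sqrt_lt (hN : Measurable N) (hc : 0 < c) (hK : 1 ≤ K)
    (h_int : Integrable (fun ω => Real.exp (N ω ^ 2 / c)) μ) (p : ℕ) :
    ∫ ω in {ω | √(c * K) < N ω}, N ω ^ p ∂μ ≤
      √(c * K) ^ p * p.factorial * Real.exp (1 - K) * ∫ ω, Real.exp (N ω ^ 2 / c) ∂μ := by
  have h_int' := h_int.const_mul (√(c * K) ^ p * p.factorial * Real.exp (1 - K))
  rw [← integral_const_mul]
  refine (setIntegral_mono_on
    (integrable_pow_of_integrable_exp_sq hN.aestronglyMeasurable hc h_int p).integrableOn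
    h_int'.integrableOn (measurableSet_lt measurable_const hN)
    fun ω hω => pow_le_of_sqrt_lt hc hK hω p).trans
    (setIntegral_le_integral h_int' (.of_forall fun ω => ?_))
  positivity

end Tail

section Truncation

/-- The truncation of a vector at norm level `ρ`: vectors of norm larger than `ρ` are replaced
by `0`, not rescaled to norm `ρ`, so that every vector of norm at most `ρ` is left unchanged. -/
noncomputable def normTruncation {E : Type*} [Norm E] [Zero E] (ρ : ℝ) : E → E :=
  {x | ‖x‖ ≤ ρ}.indicator id

variable {E : Type*} [NormedAddCommGroup E] {ρ : ℝ}

theorem normTruncation_of_norm_le {x : E} (hx : ‖x‖ ≤ ρ) : normTruncation ρ x = x :=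
  Set.indicator_of_mem (s := {x : E | ‖x‖ ≤ ρ}) hx id

theorem normTruncation_of_lt_norm {x : E} (hx : ρ < ‖x‖) : normTruncation ρ x = 0 :=
  Set.indicator_of_notMem (s := {x : E | ‖x‖ ≤ ρ}) hx.not_ge id

theorem norm_normTruncation_le (hρ : 0 ≤ ρ) (x : E) : ‖normTruncation ρ x‖ ≤ ρ := by
  rcases le_or_gt ‖x‖ ρ with h | h
  · rwa [normTruncation_of_norm_le h]
  · rwa [normTruncation_of_lt_norm h, norm_zero]

theorem norm_normTruncation_sub (x : E) :
    ‖normTruncation ρ x - x‖ = {x : E | ρ < ‖x‖}.indicator norm x := by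
  rcases le_or_gt ‖x‖ ρ with h | h
  · simp [normTruncation_of_norm_le h, h]
  · simp [normTruncation_of_lt_norm h, h]

variable [MeasurableSpace E] [OpensMeasurableSpace E]

theorem measurable_normTruncation : Measurable (normTruncation ρ : E → E) :=
  measurable_id.indicator (measurableSet_le measurable_norm measurable_const)

variable {Ω : Type*} [MeasurableSpace Ω] {μ : Measure Ω} [SecondCountableTopology E]

theorem integrable_normTruncation [IsFiniteMeasure μ] (hρ : 0 ≤ ρ) {T : Ω → E}
    (hT : Measurable T) : Integrable (fun ω => normTruncation ρ (T ω)) μ :=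
  .of_bound (measurable_normTruncation.comp hT).aestronglyMeasurable ρ
    (.of_forall fun _ => norm_normTruncation_le hρ _)

variable [NormedSpace ℝ E]

theorem norm_integral_normTruncation_sub_le [IsFiniteMeasure μ] (hρ : 0 ≤ ρ) {T : Ω → E}
    (hT : Measurable T) (h_int : Integrable T μ) :
    ‖∫ ω, normTruncation ρ (T ω) ∂μ - ∫ ω, T ω ∂μ‖ ≤ ∫ ω in {ω | ρ < ‖T ω‖}, ‖T ω‖ ∂μ := by
  rw [← integral_sub (integrable_normTruncation hρ hT) h_int,
    ← integral_indicator (measurableSet_lt measurable_const hT.norm)]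
  refine (norm_integral_le_integral_norm _).trans_eq (integral_congr_ae (.of_forall fun ω => ?_))
  exact norm_normTruncation_sub (T ω)

variable {ι : Type*} [Fintype ι] {T : ι → Ω → E}

theorem norm_sum_sub_integral_le_of_norm_le [IsFiniteMeasure μ] (hρ : 0 ≤ ρ)
    (hT : ∀ i, Measurable (T i)) (h_int : ∀ i, Integrable (T i) μ) {β : ℝ}
    (hβ : ∀ i, ∫ ω in {ω | ρ < ‖T i ω‖}, ‖T i ω‖ ∂μ ≤ β) {ω : Ω} (hω : ∀ i, ‖T i ω‖ ≤ ρ) :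
    ‖∑ i, (T i ω - ∫ ω, T i ω ∂μ)‖ ≤
      ‖∑ i, (normTruncation ρ (T i ω) - ∫ ω, normTruncation ρ (T i ω) ∂μ)‖ +
        Fintype.card ι * β := by
  have decomposition : ∑ i, (T i ω - ∫ ω, T i ω ∂μ) =
      ∑ i, (normTruncation ρ (T i ω) - ∫ ω, normTruncation ρ (T i ω) ∂μ) +
        ∑ i, (∫ ω, normTruncation ρ (T i ω) ∂μ - ∫ ω, T i ω ∂μ) := by
    simp only [← Finset.sum_add_distrib, sub_add_sub_cancel, normTruncation_of_norm_le (hω _)]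
  have bias_le : ‖∑ i, (∫ ω, normTruncation ρ (T i ω) ∂μ - ∫ ω, T i ω ∂μ)‖ ≤
      Fintype.card ι * β := by
    refine (norm_sum_le_of_le _ fun i _ =>
      (norm_integral_normTruncation_sub_le hρ (hT i) (h_int i)).trans (hβ i)).trans_eq ?_
    rw [Finset.sum_const, nsmul_eq_mul, Finset.card_univ]
  rw [decomposition]
  exact norm_add_le_of_le le_rfl bias_le

end Truncation

section TruncatedSum

variable {E : Type*} [NormedAddCommGroup E] [InnerProductSpace ℝ E] [CompleteSpace E]
  [MeasurableSpace E] [BorelSpace E] [SecondCountableTopology E] {Ω ι : Type*} [MeasurableSpace Ω]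
  {μ : Measure Ω} [IsProbabilityMeasure μ] [Fintype ι] {T : ι → Ω → E} {ρ : ℝ}

theorem measureReal_le_norm_sum_normTruncation_le (hρ : 0 ≤ ρ) (hT : ∀ i, Measurable (T i))
    (h_indep : iIndepFun T μ) {r : ℝ} (hr : 0 ≤ r) :
    μ.real {ω | r ≤ ‖∑ i, (normTruncation ρ (T i ω) - ∫ ω, normTruncation ρ (T i ω) ∂μ)‖} ≤
      2 * Real.exp (-(r ^ 2 / (8 * Fintype.card ι * ρ ^ 2))) := by
  have centered_measurable (i : ι) :
      Measurable fun x : E => normTruncation ρ x - ∫ ω, normTruncation ρ (T i ω) ∂μ :=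
    measurable_normTruncation.sub_const _
  have norm_centered_le (i : ι) (ω : Ω) :
      ‖normTruncation ρ (T i ω) - ∫ ω, normTruncation ρ (T i ω) ∂μ‖ ≤ 2 * ρ := by
    have norm_mean_le := norm_integral_le_of_norm_le_const (μ := μ)
      (.of_forall fun ω => norm_normTruncation_le hρ (T i ω))
    rw [probReal_univ, mul_one] at norm_mean_le
    exact (norm_sub_le_of_le (norm_normTruncation_le hρ _) norm_mean_le).trans_eq (two_mul ρ).symm
  refine (measureReal_le_norm_sum_le (fun i => ((centered_measurable i).comp (hT i)).aemeasurable)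
    (h_indep.comp _ centered_measurable) (fun i => .of_forall (norm_centered_le i))
    (fun i => ?_) hr).trans_eq ?_
  · simp [integral_sub (integrable_normTruncation hρ (hT i)) (integrable_const _)]
  · ring_nf

theorem measureReal_le_norm_sum_sub_integral_le (hρ : 0 ≤ ρ) (hT : ∀ i, Measurable (T i))
    (h_indep : iIndepFun T μ) (h_int : ∀ i, Integrable (T i) μ) {q β r : ℝ} (hr : 0 ≤ r)
    (hq : ∀ i, μ.real {ω | ρ < ‖T i ω‖} ≤ q)
    (hβ : ∀ i, ∫ ω in {ω | ρ < ‖T i ω‖}, ‖T i ω‖ ∂μ ≤ β) :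
    μ.real {ω | r + Fintype.card ι * β ≤ ‖∑ i, (T i ω - ∫ ω, T i ω ∂μ)‖} ≤
      Fintype.card ι * q + 2 * Real.exp (-(r ^ 2 / (8 * Fintype.card ι * ρ ^ 2))) := by
  have event_subset : {ω | r + Fintype.card ι * β ≤ ‖∑ i, (T i ω - ∫ ω, T i ω ∂μ)‖} ⊆
      (⋃ i, {ω | ρ < ‖T i ω‖}) ∪
        {ω | r ≤ ‖∑ i, (normTruncation ρ (T i ω) - ∫ ω, normTruncation ρ (T i ω) ∂μ)‖} := by
    intro ω (hω : r + Fintype.card ι * β ≤ ‖∑ i, (T i ω - ∫ ω, T i ω ∂μ)‖)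
    rw [Set.mem_union, or_iff_not_imp_left]
    intro norm_le
    simp only [Set.mem_iUnion, Set.mem_ofPred_eq, not_exists, not_lt] at norm_le ⊢
    linarith [norm_sum_sub_integral_le_of_norm_le hρ hT h_int hβ norm_le]
  have union_bound : μ.real (⋃ i, {ω | ρ < ‖T i ω‖}) ≤ Fintype.card ι * q := by
    refine (measureReal_iUnion_fintype_le _).trans ((Finset.sum_le_sum fun i _ => hq i).trans_eq ?_)
    rw [Finset.sum_const, nsmul_eq_mul, Finset.card_univ]
  exact (measureReal_mono event_subset).trans ((measureReal_union_le _ _).trans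
    (add_le_add union_bound (measureReal_le_norm_sum_normTruncation_le hρ hT h_indep hr)))

end TruncatedSum

section NormLePow

variable {E Ω : Type*} [NormedAddCommGroup E] {T : Ω → E} {N : Ω → ℝ} {p : ℕ}

theorem setOf_pow_lt_norm_subset (hN_nonneg : ∀ ω, 0 ≤ N ω) (hTN : ∀ ω, ‖T ω‖ ≤ N ω ^ p) (R : ℝ) :
    {ω | R ^ p < ‖T ω‖} ⊆ {ω | R < N ω} :=
  fun ω hω => lt_of_pow_lt_pow_left₀ p (hN_nonneg ω) (lt_of_lt_of_le hω (hTN ω))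

variable [MeasurableSpace Ω] {μ : Measure Ω} {c K : ℝ}

theorem integrable_of_norm_le_pow (hT : AEStronglyMeasurable T μ) (hN : AEStronglyMeasurable N μ)
    (hTN : ∀ ω, ‖T ω‖ ≤ N ω ^ p) (hc : 0 < c)
    (h_int : Integrable (fun ω => Real.exp (N ω ^ 2 / c)) μ) : Integrable T μ :=
  (integrable_pow_of_integrable_exp_sq hN hc h_int p).mono' hT (.of_forall hTN)

theorem measureReal_sqrt_pow_lt_norm_le [IsFiniteMeasure μ] (hN_nonneg : ∀ ω, 0 ≤ N ω)
    (hTN : ∀ ω, ‖T ω‖ ≤ N ω ^ p) (hc : 0 < c)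
    (h_int : Integrable (fun ω => Real.exp (N ω ^ 2 / c)) μ) :
    μ.real {ω | √(c * K) ^ p < ‖T ω‖} ≤ Real.exp (-K) * ∫ ω, Real.exp (N ω ^ 2 / c) ∂μ :=
  (measureReal_mono (setOf_pow_lt_norm_subset hN_nonneg hTN _)).trans
    (measureReal_sqrt_lt_le hc h_int)

theorem setIntegral_norm_le_of_sqrt_pow_lt (hT : AEStronglyMeasurable T μ) (hN : Measurable N)
    (hN_nonneg : ∀ ω, 0 ≤ N ω) (hTN : ∀ ω, ‖T ω‖ ≤ N ω ^ p) (hc : 0 < c) (hK : 1 ≤ K)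
    (h_int : Integrable (fun ω => Real.exp (N ω ^ 2 / c)) μ) :
    ∫ ω in {ω | √(c * K) ^ p < ‖T ω‖}, ‖T ω‖ ∂μ ≤
      √(c * K) ^ p * p.factorial * Real.exp (1 - K) * ∫ ω, Real.exp (N ω ^ 2 / c) ∂μ := by
  have hN_int := integrable_pow_of_integrable_exp_sq hN.aestronglyMeasurable hc h_int p
  have hT_int := integrable_of_norm_le_pow hT hN.aestronglyMeasurable hTN hc h_int
  calc ∫ ω in {ω | √(c * K) ^ p < ‖T ω‖}, ‖T ω‖ ∂μ
      ≤ ∫ ω in {ω | √(c * K) ^ p < ‖T ω‖}, N ω ^ p ∂μ :=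
        setIntegral_mono hT_int.norm.integrableOn hN_int.integrableOn hTN
    _ ≤ ∫ ω in {ω | √(c * K) < N ω}, N ω ^ p ∂μ :=
        setIntegral_mono_set hN_int.integrableOn
          (.of_forall fun ω => pow_nonneg (hN_nonneg ω) p)
          (setOf_pow_lt_norm_subset hN_nonneg hTN _).eventuallyLE
    _ ≤ _ := setIntegral_pow_le_of_sqrt_lt hN hc hK h_int p

theorem one_le_integral_exp_sq [IsProbabilityMeasure μ] (hc : 0 < c)
    (h_int : Integrable (fun ω => Real.exp (N ω ^ 2 / c)) μ) :
    1 ≤ ∫ ω, Real.exp (N ω ^ 2 / c) ∂μ := by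
  calc (1 : ℝ) = ∫ _, (1 : ℝ) ∂μ := by simp
    _ ≤ ∫ ω, Real.exp (N ω ^ 2 / c) ∂μ :=
      integral_mono (integrable_const _) h_int fun ω => Real.one_le_exp (by positivity)

end NormLePow

section HilbertSpace

variable {E : Type*} [NormedAddCommGroup E] [InnerProductSpace ℝ E] [CompleteSpace E]
  [MeasurableSpace E] [BorelSpace E] [SecondCountableTopology E] {Ω ι : Type*} [MeasurableSpace Ω]
  {μ : Measure Ω} [IsProbabilityMeasure μ] [Fintype ι] {T : ι → Ω → E} {N : ι → Ω → ℝ} {p : ℕ}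
  {c A K : ℝ}

theorem measureReal_le_norm_sum_sub_integral_le_of_exp_sq (hT : ∀ i, Measurable (T i))
    (h_indep : iIndepFun T μ) (hN : ∀ i, Measurable (N i)) (hN_nonneg : ∀ i ω, 0 ≤ N i ω)
    (hTN : ∀ i ω, ‖T i ω‖ ≤ N i ω ^ p) (hc : 0 < c)
    (h_int : ∀ i, Integrable (fun ω => Real.exp (N i ω ^ 2 / c)) μ)
    (hA : ∀ i, ∫ ω, Real.exp (N i ω ^ 2 / c) ∂μ ≤ A) (hK : 1 ≤ K) {r : ℝ} (hr : 0 ≤ r) :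
    μ.real {ω | √(c * K) ^ p * (r + p.factorial * (Real.exp (1 - K) * (Fintype.card ι * A))) ≤
        ‖∑ i, (T i ω - ∫ ω, T i ω ∂μ)‖} ≤
      Real.exp (-K) * (Fintype.card ι * A) +
        2 * Real.exp (-(r ^ 2 / (8 * Fintype.card ι))) := by
  set R := √(c * K)
  have R_pos : 0 < R := Real.sqrt_pos.2 (by positivity)
  have tail_le (i : ι) : μ.real {ω | R ^ p < ‖T i ω‖} ≤ Real.exp (-K) * A :=
    (measureReal_sqrt_pow_lt_norm_le (hN_nonneg i) (hTN i) hc (h_int i)).trans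
      (mul_le_mul_of_nonneg_left (hA i) (Real.exp_pos _).le)
  have bias_le (i : ι) : ∫ ω in {ω | R ^ p < ‖T i ω‖}, ‖T i ω‖ ∂μ ≤
      R ^ p * p.factorial * Real.exp (1 - K) * A :=
    (setIntegral_norm_le_of_sqrt_pow_lt (hT i).aestronglyMeasurable (hN i) (hN_nonneg i) (hTN i)
      hc hK (h_int i)).trans (mul_le_mul_of_nonneg_left (hA i) (by positivity))
  have T_int (i : ι) : Integrable (T i) μ :=
    integrable_of_norm_le_pow (hT i).aestronglyMeasurable (hN i).aestronglyMeasurable (hTN i) hc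
      (h_int i)
  have hoeffding_exponent : (R ^ p * r) ^ 2 / (8 * Fintype.card ι * (R ^ p) ^ 2) =
      r ^ 2 / (8 * Fintype.card ι) := by
    rw [mul_pow, mul_comm (8 * (Fintype.card ι : ℝ)),
      mul_div_mul_left _ _ (pow_pos (pow_pos R_pos p) 2).ne']
  have deviation := measureReal_le_norm_sum_sub_integral_le (r := R ^ p * r) (by positivity) hT
    h_indep T_int (by positivity) tail_le bias_le
  rw [hoeffding_exponent, mul_left_comm _ (Real.exp _)] at deviation
  convert deviation using 5
  ring

theorem measureReal_le_norm_sum_sub_integral_le_exp [Nonempty ι] (hT : ∀ i, Measurable (T i))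
    (h_indep : iIndepFun T μ) (hN : ∀ i, Measurable (N i)) (hN_nonneg : ∀ i ω, 0 ≤ N i ω)
    (hTN : ∀ i ω, ‖T i ω‖ ≤ N i ω ^ p) (hc : 0 < c)
    (h_int : ∀ i, Integrable (fun ω => Real.exp (N i ω ^ 2 / c)) μ)
    (hA : ∀ i, ∫ ω, Real.exp (N i ω ^ 2 / c) ∂μ ≤ A) {l : ℝ} (hl : 0 ≤ l)
    (hK : Fintype.card ι * A ≤ Real.exp (K - (l + 1))) :
    μ.real {ω | √(c * K) ^ p * (√(8 * Fintype.card ι * (l + 2)) + p.factorial) ≤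
      ‖∑ i, (T i ω - ∫ ω, T i ω ∂μ)‖} ≤ Real.exp (-l) := by
  have one_le_card_mul : 1 ≤ Fintype.card ι * A :=
    one_le_mul_of_one_le_of_one_le (Nat.one_le_cast.2 Fintype.card_pos)
      ((one_le_integral_exp_sq hc (h_int (Classical.arbitrary ι))).trans (hA _))
  have one_le_K : 1 ≤ K := by
    have := Real.one_le_exp_iff.1 (one_le_card_mul.trans hK)
    linarith
  have bias_le_one : Real.exp (1 - K) * (Fintype.card ι * A) ≤ 1 := by
    refine (mul_le_mul_of_nonneg_left hK (Real.exp_pos _).le).trans ?_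
    rw [← Real.exp_add, Real.exp_le_one_iff]
    linarith
  have tail_le : Real.exp (-K) * (Fintype.card ι * A) ≤ Real.exp (-1) * Real.exp (-l) := by
    refine (mul_le_mul_of_nonneg_left hK (Real.exp_pos _).le).trans_eq ?_
    rw [← Real.exp_add, ← Real.exp_add]
    ring_nf
  have hoeffding_eq : Real.exp (-(√(8 * Fintype.card ι * (l + 2)) ^ 2 / (8 * Fintype.card ι))) =
      Real.exp (-1) * Real.exp (-1) * Real.exp (-l) := by
    rw [Real.sq_sqrt (by positivity), mul_div_cancel_left₀ _ (by positivity), ← Real.exp_add,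
      ← Real.exp_add]
    ring_nf
  have sum_le : Real.exp (-1) + 2 * (Real.exp (-1) * Real.exp (-1)) ≤ 1 := by
    nlinarith [Real.exp_neg_one_lt_d9, Real.exp_pos (-1)]
  refine (measureReal_mono fun ω hω => ?_).trans
    ((measureReal_le_norm_sum_sub_integral_le_of_exp_sq hT h_indep hN hN_nonneg hTN hc h_int hA
      one_le_K (Real.sqrt_nonneg (8 * Fintype.card ι * (l + 2)))).trans ?_)
  · rw [Set.mem_ofPred_eq] at hω ⊢
    refine le_trans ?_ hω
    gcongr
    exact mul_le_of_le_one_right (by positivity) bias_le_one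
  · rw [hoeffding_eq]
    linarith [mul_le_mul_of_nonneg_right sum_le (Real.exp_pos (-l)).le]

end HilbertSpace

section Level

theorem natCast_mul_exp_le_exp_log {n : ℕ} (hn : 2 ≤ n) {D l : ℝ} (hD : 1 ≤ D) (hl : 0 ≤ l) :
    n * (3 * Real.exp (D / 2)) ≤ Real.exp (8 * ((D + l) * Real.log n) - (l + 1)) := by
  have log_ge : 0.69 ≤ Real.log n :=
    (by linarith [Real.log_two_gt_d9] : 0.69 ≤ Real.log 2).trans
      (Real.log_le_log two_pos (by exact_mod_cast hn))
  have three_le_exp_two : 3 ≤ Real.exp 2 := by linarith [Real.add_one_le_exp 2]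
  calc n * (3 * Real.exp (D / 2)) ≤ Real.exp (Real.log n) * (Real.exp 2 * Real.exp (D / 2)) := by
        rw [Real.exp_log (by positivity)]
        gcongr
    _ = Real.exp (Real.log n + (2 + D / 2)) := by rw [Real.exp_add, Real.exp_add]
    _ ≤ _ := Real.exp_le_exp.2 (by nlinarith)

theorem deviation_level_le {n : ℕ} (hn : 0 < n) (p : ℕ) {σ D L l : ℝ} (hσ : 0 ≤ σ) (hL : 0 ≤ L)
    (hD : 1 ≤ D) (hl : l + 2 ≤ 2 * D) :
    1 / n * (√(8 * σ ^ 2 * (8 * (D * L))) ^ p * (√(8 * n * (l + 2)) + p.factorial)) ≤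
      8 ^ p * (4 + p.factorial) * σ ^ p * √(D ^ (p + 1) * L ^ p / n) := by
  have one_le_n : (1 : ℝ) ≤ n := Nat.one_le_cast.2 hn
  have truncation_level : √(8 * σ ^ 2 * (8 * (D * L))) = 8 * σ * √(D * L) := by
    rw [show 8 * σ ^ 2 * (8 * (D * L)) = (8 * σ) ^ 2 * (D * L) by ring,
      Real.sqrt_mul (sq_nonneg _), Real.sqrt_sq (by positivity)]
  have hoeffding_level : √(8 * n * (l + 2)) ≤ 4 * √(n * D) := by
    rw [Real.sqrt_le_left (by positivity), mul_pow, Real.sq_sqrt (by positivity)]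
    calc 8 * n * (l + 2) ≤ 8 * n * (2 * D) := by gcongr
      _ = 4 ^ 2 * (n * D) := by ring
  have one_le_sqrt : 1 ≤ √(n * D) :=
    Real.one_le_sqrt.2 (one_le_mul_of_one_le_of_one_le one_le_n hD)
  have sqrt_mul_div : 1 / n * √(n * D) = √(D / n) := by
    rw [← Real.sqrt_sq (by positivity : (0 : ℝ) ≤ 1 / n), ← Real.sqrt_mul (sq_nonneg _)]
    congr 1
    field_simp
  have sqrt_factor : √(D ^ (p + 1) * L ^ p / n) = √(D * L) ^ p * √(D / n) := by
    rw [← Real.sqrt_sq (by positivity : 0 ≤ √(D * L) ^ p), ← Real.sqrt_mul (sq_nonneg _),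
      ← pow_mul, mul_comm p, pow_mul, Real.sq_sqrt (by positivity)]
    ring_nf
  calc 1 / n * (√(8 * σ ^ 2 * (8 * (D * L))) ^ p * (√(8 * n * (l + 2)) + p.factorial))
      ≤ 1 / n * ((8 * σ * √(D * L)) ^ p * (4 * √(n * D) + p.factorial * √(n * D))) := by
        rw [truncation_level]
        gcongr
        exact le_mul_of_one_le_right (by positivity) one_le_sqrt
    _ = 8 ^ p * (4 + p.factorial) * σ ^ p * (√(D * L) ^ p * (1 / n * √(n * D))) := by ring
    _ = _ := by rw [sqrt_mul_div, sqrt_factor]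

end Level

namespace Tensor

variable {p d : ℕ}

theorem frobNorm_eq_norm_toLp (A : Tensor p d) : frobNorm A = ‖WithLp.toLp 2 A‖ := by
  simp [EuclideanSpace.norm_eq, frobNorm]

theorem opNorm_le_frobNorm (A : Tensor p d) : opNorm A ≤ frobNorm A := by
  refine Real.sSup_le ?_ (Real.sqrt_nonneg _)
  rintro r ⟨x, hx, rfl⟩
  calc scalarProd A (outer x) ≤ frobNorm A * frobNorm (outer x) :=
        Real.sum_mul_le_sqrt_mul_sqrt _ _ _
    _ ≤ frobNorm A := mul_le_of_le_one_right (Real.sqrt_nonneg _) hx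

theorem frobNorm_outer (x : Fin p → EuclideanSpace ℝ (Fin d)) :
    frobNorm (outer x) = ∏ k, ‖x k‖ := by
  have sum_sq : ∑ J, outer x J ^ 2 = (∏ k, ‖x k‖) ^ 2 := by
    simp only [outer, ← Finset.prod_pow, EuclideanSpace.real_norm_sq_eq, Fintype.prod_sum]
  rw [frobNorm, sum_sq, Real.sqrt_sq (Finset.prod_nonneg fun k _ => norm_nonneg (x k))]

theorem norm_toLp_power (x : EuclideanSpace ℝ (Fin d)) :
    ‖WithLp.toLp 2 (power p x)‖ = ‖x‖ ^ p := by
  rw [← frobNorm_eq_norm_toLp, power, frobNorm_outer, Finset.prod_const, Finset.card_univ,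
    Fintype.card_fin]

theorem measurable_power : Measurable (power p : EuclideanSpace ℝ (Fin d) → Tensor p d) := by
  unfold power outer
  fun_prop

variable {Ω : Type*} {n : ℕ}

theorem toLp_empiricalMean (T : Fin n → Ω → Tensor p d) (ω : Ω) :
    WithLp.toLp 2 (empiricalMean T ω) = (1 / n : ℝ) • ∑ i, WithLp.toLp 2 (T i ω) := by
  ext J
  simp [empiricalMean]

variable [MeasurableSpace Ω] {μ : Measure Ω}

theorem toLp_expectation {T : Ω → Tensor p d} (hT : Integrable (fun ω => WithLp.toLp 2 (T ω)) μ) :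
    WithLp.toLp 2 (expectation μ T) = ∫ ω, WithLp.toLp 2 (T ω) ∂μ := by
  ext J
  exact (EuclideanSpace.proj (𝕜 := ℝ) J).integral_comp_comm hT

theorem frobNorm_empiricalMean_sub_expectation {T : Fin n → Ω → Tensor p d}
    (hT : ∀ i, Integrable (fun ω => WithLp.toLp 2 (T i ω)) μ) (ω : Ω) :
    frobNorm (empiricalMean T ω - expectation μ (empiricalMean T)) =
      1 / n * ‖∑ i, (WithLp.toLp 2 (T i ω) - ∫ ω, WithLp.toLp 2 (T i ω) ∂μ)‖ := by
  have mean_int : Integrable (fun ω => WithLp.toLp 2 (empiricalMean T ω)) μ := by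
    simp only [toLp_empiricalMean]
    exact (integrable_finsetSum _ fun i _ => hT i).smul (1 / n : ℝ)
  rw [frobNorm_eq_norm_toLp, WithLp.toLp_sub, toLp_expectation mean_int]
  simp only [toLp_empiricalMean]
  rw [integral_smul, integral_finsetSum _ fun i _ => hT i, ← smul_sub, ← Finset.sum_sub_distrib,
    norm_smul, Real.norm_of_nonneg (by positivity)]

end Tensor

namespace IsSymmRankOneSubgaussian

variable {p d : ℕ} {Ω : Type*} [MeasurableSpace Ω] {μ : Measure Ω}
  {S : Matrix (Fin d) (Fin d) ℝ}

theorem measurable {T : Ω → Tensor p d} (hT : IsSymmRankOneSubgaussian S T μ) : Measurable T := by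
  obtain ⟨X, hX, hTX⟩ := hT
  rw [funext hTX]
  exact Tensor.measurable_power.comp hX.1

variable [IsProbabilityMeasure μ]

theorem integrable_toLp (hd : 1 ≤ d) (hS : S.PosDef) {T : Ω → Tensor p d}
    (hT : IsSymmRankOneSubgaussian S T μ) : Integrable (fun ω => WithLp.toLp 2 (T ω)) μ := by
  have toLp_measurable : Measurable fun ω => WithLp.toLp 2 (T ω) :=
    (WithLp.measurable_toLp 2 _).comp hT.measurable
  obtain ⟨X, hX, hTX⟩ := hT
  have hσ := sigmaOne_pos hd hS
  exact integrable_of_norm_le_pow toLp_measurable.aestronglyMeasurable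
    hX.1.norm.aestronglyMeasurable (fun ω => (hTX ω ▸ Tensor.norm_toLp_power (X ω)).le)
    (by positivity) (hX.integrable_exp_norm_sq hd hS)

theorem integrable_apply (hd : 1 ≤ d) (hS : S.PosDef) {T : Ω → Tensor p d}
    (hT : IsSymmRankOneSubgaussian S T μ) (J : Fin p → Fin d) :
    Integrable (fun ω => T ω J) μ :=
  (EuclideanSpace.proj (𝕜 := ℝ) J).integrable_comp (hT.integrable_toLp hd hS)

theorem measureReal_le_norm_sum_le {n : ℕ} (hd : 1 ≤ d) (hn : 2 ≤ n) (hS : S.PosDef)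
    {T : Fin n → Ω → Tensor p d} (h_indep : iIndepFun T μ)
    (hT : ∀ i, IsSymmRankOneSubgaussian S (T i) μ) {l : ℝ} (hl : 0 ≤ l) :
    μ.real {ω | √(8 * sigmaOne hS ^ 2 * (8 * ((effDim hS + l) * Real.log n))) ^ p *
        (√(8 * n * (l + 2)) + p.factorial) ≤
      ‖∑ i, (WithLp.toLp 2 (T i ω) - ∫ ω, WithLp.toLp 2 (T i ω) ∂μ)‖} ≤ Real.exp (-l) := by
  have hσ := sigmaOne_pos hd hS
  have : Nonempty (Fin n) := ⟨⟨0, by omega⟩⟩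
  have toLp_measurable (i : Fin n) : Measurable fun ω => WithLp.toLp 2 (T i ω) :=
    (WithLp.measurable_toLp 2 _).comp (hT i).measurable
  choose X hX hTX using hT
  simpa only [Fintype.card_fin] using measureReal_le_norm_sum_sub_integral_le_exp
    (T := fun i ω => WithLp.toLp 2 (T i ω)) (c := 8 * sigmaOne hS ^ 2) toLp_measurable
    (h_indep.comp _ fun _ => WithLp.measurable_toLp 2 _) (fun i => (hX i).1.norm)
    (fun i ω => norm_nonneg (X i ω))
    (fun i ω => (hTX i ω ▸ Tensor.norm_toLp_power (X i ω)).le) (by positivity)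
    (fun i => (hX i).integrable_exp_norm_sq hd hS)
    (fun i => (hX i).integral_exp_norm_sq_le hd hS) hl
    ((Fintype.card_fin n).symm ▸ natCast_mul_exp_le_exp_log hn (one_le_effDim hd hS) hl)

theorem measureReal_le_frobNorm_empiricalMean_le {n : ℕ} (hd : 1 ≤ d) (hn : 2 ≤ n)
    (hS : S.PosDef) {T : Fin n → Ω → Tensor p d} (h_indep : iIndepFun T μ)
    (hT : ∀ i, IsSymmRankOneSubgaussian S (T i) μ) {l : ℝ} (hl : 0 ≤ l) :
    μ.real {ω | 8 ^ p * (4 + p.factorial) * sigmaOne hS ^ p *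
        √((effDim hS + l) ^ (p + 1) * Real.log n ^ p / n) ≤
      Tensor.frobNorm (Tensor.empiricalMean T ω -
        Tensor.expectation μ (Tensor.empiricalMean T))} ≤ Real.exp (-l) := by
  have one_le_D := one_le_effDim hd hS
  have level_le := deviation_level_le (n := n) (by omega) p (sigmaOne_pos hd hS).le
    (Real.log_natCast_nonneg n) (D := effDim hS + l) (l := l) (by linarith) (by linarith)
  refine (measureReal_mono fun ω hω => ?_).trans
    (measureReal_le_norm_sum_le hd hn hS h_indep hT hl)
  rw [Set.mem_ofPred_eq, Tensor.frobNorm_empiricalMean_sub_expectation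
    fun i => (hT i).integrable_toLp hd hS] at hω
  exact le_of_mul_le_mul_left (level_le.trans hω) (by positivity)

end IsSymmRankOneSubgaussian

theorem one_sub_le_measureReal_of_tail_le_exp {Ω : Type*} [MeasurableSpace Ω] {μ : Measure Ω}
    [IsProbabilityMeasure μ] {f : Ω → ℝ} {a : ℝ → ℝ}
    (h_tail : ∀ l, 0 < l → μ.real {ω | a l ≤ f ω} ≤ Real.exp (-l)) {δ : ℝ} (hδ : 0 < δ) :
    1 - δ ≤ μ.real {ω | f ω ≤ a (Real.log δ⁻¹)} := by
  rcases le_or_gt 1 δ with one_le | lt_one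
  · exact (sub_nonpos.2 one_le).trans measureReal_nonneg
  · have tail_le := h_tail _ (Real.log_pos ((one_lt_inv₀ hδ).2 lt_one))
    rw [Real.exp_neg, Real.exp_log (inv_pos.2 hδ), inv_inv] at tail_le
    have cover : 1 ≤ μ.real {ω | f ω ≤ a (Real.log δ⁻¹)} + μ.real {ω | a (Real.log δ⁻¹) ≤ f ω} := by
      rw [← probReal_univ (μ := μ)]
      exact (measureReal_mono fun ω _ => le_total (f ω) _).trans (measureReal_union_le _ _)
    linarith

theorem Tensor.measureReal_le_opNorm_le {p d : ℕ} {Ω : Type*} [MeasurableSpace Ω] {μ : Measure Ω}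
    [IsFiniteMeasure μ] (A : Ω → Tensor p d) (n : ℕ) {B D l : ℝ} (hB : 0 ≤ B)
    (hD : 0 ≤ D + l) :
    μ.real {ω | B * √((D + Real.log d + l) ^ (p + 1) * Real.log n ^ p / n) ≤ opNorm (A ω)} ≤
      μ.real {ω | B * √((D + l) ^ (p + 1) * Real.log n ^ p / n) ≤ frobNorm (A ω)} := by
  refine measureReal_mono fun ω hω => ?_
  calc B * √((D + l) ^ (p + 1) * Real.log n ^ p / n)
      ≤ B * √((D + Real.log d + l) ^ (p + 1) * Real.log n ^ p / n) := by
        have := Real.log_natCast_nonneg n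
        gcongr
        linarith [Real.log_natCast_nonneg d]
    _ ≤ opNorm (A ω) := hω
    _ ≤ frobNorm (A ω) := opNorm_le_frobNorm _

theorem Tensor.measureReal_opNorm_le_of_frobNorm_tail {p d : ℕ} {Ω : Type*} [MeasurableSpace Ω]
    {μ : Measure Ω} [IsProbabilityMeasure μ] {A : Ω → Tensor p d} {n : ℕ} {B D : ℝ} (hB : 0 ≤ B)
    (hD : 0 ≤ D)
    (h_tail : ∀ l, 0 ≤ l → μ.real {ω | B * √((D + l) ^ (p + 1) * Real.log n ^ p / n) ≤
      frobNorm (A ω)} ≤ Real.exp (-l)) :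
    (∀ δ, 0 < δ → 1 - δ ≤ μ.real {ω | opNorm (A ω) ≤
      B * √((D + Real.log d + Real.log δ⁻¹) ^ (p + 1) * Real.log n ^ p / n)}) ∧
    ∀ l, 0 < l → μ.real {ω | B * √((D + Real.log d + l) ^ (p + 1) * Real.log n ^ p / n) ≤
      opNorm (A ω)} ≤ Real.exp (-l) := by
  have opNorm_tail (l : ℝ) (hl : 0 < l) :=
    (measureReal_le_opNorm_le A n hB (add_nonneg hD hl.le)).trans (h_tail l hl.le)
  exact ⟨fun _ => one_sub_le_measureReal_of_tail_le_exp opNorm_tail, opNorm_tail⟩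

theorem theorem3_general (p : ℕ) :
    ∃ C : ℝ, 0 < C ∧
      ∀ (d n : ℕ), 1 ≤ d → 2 ≤ n →
      ∀ (S : Matrix (Fin d) (Fin d) ℝ) (hS : S.PosDef)
        (Ω : Type*) [MeasurableSpace Ω] (μ : Measure Ω) [IsProbabilityMeasure μ]
        (T : Fin n → Ω → Tensor p d),
        iIndepFun T μ →
        (∀ i, IsSymmRankOneSubgaussian S (T i) μ) →
        (∀ i J, Integrable (fun ω => T i ω J) μ) ∧
        (∀ l : ℝ, 0 ≤ l →
          μ.real {ω |
            C * sigmaOne hS ^ p * √((effDim hS + l) ^ (p + 1) * Real.log n ^ p / n) ≤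
              Tensor.frobNorm (Tensor.empiricalMean T ω -
                Tensor.expectation μ (Tensor.empiricalMean T))} ≤
            Real.exp (-l)) :=
  ⟨8 ^ p * (4 + p.factorial), by positivity, fun _ _ hd hn _ hS _ _ _ _ _ h_indep hT =>
    ⟨fun i => (hT i).integrable_apply hd hS, fun _ =>
      IsSymmRankOneSubgaussian.measureReal_le_frobNorm_empiricalMean_le hd hn hS h_indep hT⟩⟩

theorem theorem3 (p : ℕ) (hp : 1 ≤ p) :
    ∃ C : ℝ, 0 < C ∧
      ∀ (d n : ℕ), 1 ≤ d → 2 ≤ n →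
      ∀ (S : Matrix (Fin d) (Fin d) ℝ) (hS : S.PosDef)
        (Ω : Type*) [MeasurableSpace Ω] (μ : Measure Ω) [IsProbabilityMeasure μ]
        (T : Fin n → Ω → Tensor p d),
        iIndepFun T μ →
        (∀ i j, IdentDistrib (T i) (T j) μ μ) →
        (∀ i, IsSymmRankOneSubgaussian S (T i) μ) →
        (∀ i J, Integrable (fun ω => T i ω J) μ) ∧
        (∀ δ : ℝ, 0 < δ →
          1 - δ ≤ μ.real {ω |
            Tensor.opNorm (Tensor.empiricalMean T ω -
                Tensor.expectation μ (Tensor.empiricalMean T)) ≤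
              C * sigmaOne hS ^ p *
                Real.sqrt ((effDim hS + Real.log d + Real.log δ⁻¹) ^ (p + 1) *
                  Real.log n ^ p / n)}) ∧
        (∀ l : ℝ, 0 < l →
          μ.real {ω |
            C * sigmaOne hS ^ p *
                Real.sqrt ((effDim hS + Real.log d + l) ^ (p + 1) * Real.log n ^ p / n) ≤
              Tensor.opNorm (Tensor.empiricalMean T ω -
                Tensor.expectation μ (Tensor.empiricalMean T))} ≤
            Real.exp (-l)) := by
  obtain ⟨C, C_pos, h⟩ := theorem3_general p
  exact ⟨C, C_pos, fun d n hd hn S hS Ω _ μ _ T h_indep _ hT =>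
    (h d n hd hn S hS Ω μ T h_indep hT).imp_right <| Tensor.measureReal_opNorm_le_of_frobNorm_tail
      (mul_nonneg C_pos.le (pow_nonneg (sigmaOne_pos hd hS).le p))
      (zero_le_one.trans (one_le_effDim hd hS))⟩
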